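/- All rings are commutative and Noetherian with identity. A ring $A$ satisfies the symmetric Auslander condition (SAC) if for every finitely generated $A$-module $M$ such that $\operatorname{Ext}^i_A(M,A)=0$ for all $i>0$ and $\operatorname{Ext}^i_A(M,M)=0$ for all sufficiently large $i$, one has $\operatorname{Ext}^i_A(M,M)=0$ for all $i>0$. Let $(R,\mathfrak m)$ be a Noetherian local ring and let $x\in\mathfrak m$ be a non-zerodivisor on $R$ (so that $R$ has positive depth). Then $R$ satisfies (SAC) if and only if $R/xR$ satisfies (SAC). -/

import Mathlib

open CategoryTheory

universe u

/-- The symmetric Auslander condition (SAC) for a commutative ring `R`: for each finitely generated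
`R`-module `M`, if `Ext^i_R(M, R) = 0` for all `i > 0` and `Ext^i_R(M, M) = 0` for all large enough
`i`, then `Ext^i_R(M, M) = 0` for all `i > 0`. (Every finitely generated `R`-module is isomorphic to
one in the universe of `R`.) -/
def SAC (R : Type u) [CommRing R] : Prop :=
  ∀ M : ModuleCat.{u} R, Module.Finite R M →
    (∀ i : ℕ, 0 < i → Subsingleton (Abelian.Ext M (ModuleCat.of R R) i)) →
    (∃ n : ℕ, ∀ i : ℕ, n < i → Subsingleton (Abelian.Ext M M i)) →
    ∀ i : ℕ, 0 < i → Subsingleton (Abelian.Ext M M i)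

open Abelian Pointwise

/-! Write `S = R/xR`. If `x` is regular on `M`, then `Ext_S(M/xM, -)` and `Ext_R(M, -)` vanish
together on `S`-modules (`extVanishes_iff`), and Nakayama lifts vanishing along `L → L/xL`
(`of_smul_exact`).

From `S` to `R`: replace `M` by a first syzygy `K`, on which `x` is regular. Since `Ext^i(M, R) = 0`
for `i > 0`, `K` and `M` have the same self-Ext vanishing; apply (SAC) to `K/xK` and lift back.

From `R` to `S`: let `M` be the `R`-syzygy of an `S`-module `N`, and `N₁` its `S`-syzygy. The
sequence `0 → N → M/xM → N₁ → 0` shows that `M` satisfies the hypotheses of (SAC) over `R`; the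
conclusion gives `Ext_S^i(M/xM, N) = 0` for `i > 0`. Hence `Ext^i(N, N)` embeds in `Ext^{i+1}(N₁, N)
≅ Ext^{i+2}(N, N)`, and vanishing descends two degrees at a time. -/

/-- Vanishing of `Ext^i_R(M, N)` for unbundled modules. -/
abbrev ExtVanishes (R : Type u) [CommRing R] (M N : Type u) [AddCommGroup M] [Module R M]
    [AddCommGroup N] [Module R N] (i : ℕ) : Prop :=
  Subsingleton (Ext (ModuleCat.of R M) (ModuleCat.of R N) i)

namespace ExtVanishes

/-! ### Long exact sequences and dimension shifting -/

section LongExactSequence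

variable {R : Type u} [CommRing R] {A B C : Type u} [AddCommGroup A] [Module R A]
  [AddCommGroup B] [Module R B] [AddCommGroup C] [Module R C]
  (L : Type u) [AddCommGroup L] [Module R L] {f : A →ₗ[R] B} {g : B →ₗ[R] C}

theorem shortExact (hf : Function.Injective f) (hfg : Function.Exact f g)
    (hg : Function.Surjective g) :
    (ModuleCat.shortComplexOfCompEqZero f g hfg.linearMap_comp_eq_zero).ShortExact :=
  ModuleCat.shortComplex_shortExact _ hfg hf hg

theorem of_projective [Module.Projective R A] {i : ℕ} (hi : 0 < i) : ExtVanishes R A L i := by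
  obtain ⟨j, rfl⟩ : ∃ j, i = j + 1 := ⟨i - 1, by lia⟩
  have : Projective (ModuleCat.of R A) := (IsProjective.iff_projective A).mp inferInstance
  exact Ext.subsingleton_of_projective _ _ _

variable {L} (hf : Function.Injective f) (hfg : Function.Exact f g) (hg : Function.Surjective g)
include hf hfg hg

theorem covariant_middle {i : ℕ} (hA : ExtVanishes R L A i) (hC : ExtVanishes R L C i) :
    ExtVanishes R L B i := by
  refine subsingleton_of_forall_eq 0 fun e ↦ ?_
  obtain ⟨a, rfl⟩ := Ext.covariant_sequence_exact₂ _ (shortExact hf hfg hg) e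
    (hC.elim _ _)
  rw [hA.elim a 0, Ext.zero_comp]

theorem covariant_right {i : ℕ} (hB : ExtVanishes R L B i) (hA : ExtVanishes R L A (i + 1)) :
    ExtVanishes R L C i := by
  refine subsingleton_of_forall_eq 0 fun e ↦ ?_
  obtain ⟨a, rfl⟩ := Ext.covariant_sequence_exact₃ _ (shortExact hf hfg hg) e rfl
    (hA.elim _ _)
  rw [hB.elim a 0, Ext.zero_comp]

theorem covariant_left {i : ℕ} (hC : ExtVanishes R L C i) (hB : ExtVanishes R L B (i + 1)) :
    ExtVanishes R L A (i + 1) := by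
  refine subsingleton_of_forall_eq 0 fun e ↦ ?_
  obtain ⟨a, rfl⟩ := Ext.covariant_sequence_exact₁ _ (shortExact hf hfg hg) e
    (hB.elim _ _) rfl
  rw [hC.elim a 0, Ext.zero_comp]

theorem contravariant_middle {i : ℕ} (hA : ExtVanishes R A L i) (hC : ExtVanishes R C L i) :
    ExtVanishes R B L i := by
  refine subsingleton_of_forall_eq 0 fun e ↦ ?_
  obtain ⟨a, rfl⟩ := Ext.contravariant_sequence_exact₂ (shortExact hf hfg hg) _ e
    (hA.elim _ _)
  rw [hC.elim a 0, Ext.comp_zero]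

theorem contravariant_left {i : ℕ} (hB : ExtVanishes R B L i) (hC : ExtVanishes R C L (i + 1)) :
    ExtVanishes R A L i := by
  refine subsingleton_of_forall_eq 0 fun e ↦ ?_
  obtain ⟨a, rfl⟩ := Ext.contravariant_sequence_exact₁ (shortExact hf hfg hg) _ e
    (add_comm 1 i) (hC.elim _ _)
  rw [hB.elim a 0, Ext.comp_zero]

theorem contravariant_right {i : ℕ} (hA : ExtVanishes R A L i) (hB : ExtVanishes R B L (i + 1)) :
    ExtVanishes R C L (i + 1) := by
  refine subsingleton_of_forall_eq 0 fun e ↦ ?_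
  obtain ⟨a, rfl⟩ := Ext.contravariant_sequence_exact₃ (shortExact hf hfg hg) _ e
    (hB.elim _ _) (add_comm 1 i)
  rw [hA.elim a 0, Ext.comp_zero]

theorem syzygy_iff [Module.Projective R B] {i : ℕ} (hi : 0 < i) :
    ExtVanishes R A L i ↔ ExtVanishes R C L (i + 1) :=
  ⟨fun h ↦ contravariant_right hf hfg hg h (of_projective L i.succ_pos),
    fun h ↦ contravariant_left hf hfg hg (of_projective L hi) h⟩

/-- Puts degree 1 in terms of Hom alone, where `R` and `S` can be compared directly. -/
theorem one_iff_exists_extension [Module.Projective R B] :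
    ExtVanishes R C L 1 ↔ ∀ φ : A →ₗ[R] L, ∃ ψ : B →ₗ[R] L, ψ ∘ₗ f = φ := by
  have hS := shortExact hf hfg hg
  constructor
  · intro h φ
    obtain ⟨e, he⟩ := Ext.contravariant_sequence_exact₁ hS (ModuleCat.of R L)
      (Ext.mk₀ (ModuleCat.ofHom φ)) (add_zero 1) (h.elim _ _)
    obtain ⟨ψ, rfl⟩ := (Ext.mk₀_bijective _ _).2 e
    rw [Ext.mk₀_comp_mk₀, (Ext.mk₀_bijective _ _).1.eq_iff] at he
    exact ⟨ψ.hom, congrArg ModuleCat.Hom.hom he⟩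
  · intro h
    refine subsingleton_of_forall_eq 0 fun e ↦ ?_
    obtain ⟨a, rfl⟩ := Ext.contravariant_sequence_exact₃ hS _ e
      ((of_projective (A := B) L one_pos).elim _ _) (add_zero 1)
    obtain ⟨φ, rfl⟩ := (Ext.mk₀_bijective _ _).2 a
    obtain ⟨ψ, hψ⟩ := h φ.hom
    have : φ = (ModuleCat.shortComplexOfCompEqZero f g hfg.linearMap_comp_eq_zero).f ≫
        ModuleCat.ofHom ψ := by
      ext1
      exact hψ.symm
    rw [this, ← Ext.mk₀_comp_mk₀, hS.extClass_comp_assoc]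

end LongExactSequence

/-! ### Free coefficients and Nakayama -/

section Noetherian

variable {R : Type u} [CommRing R] {M L : Type u} [AddCommGroup M] [Module R M]
  [AddCommGroup L] [Module R L]

theorem pi_fin {i : ℕ} (h : ExtVanishes R M R i) (n : ℕ) : ExtVanishes R M (Fin n → R) i := by
  induction n with
  | zero =>
    have h0 : CategoryTheory.Limits.IsZero (ModuleCat.of R (Fin 0 → R)) :=
      ModuleCat.isZero_of_subsingleton _
    refine subsingleton_of_forall_eq 0 fun e ↦ ?_
    rw [← e.comp_mk₀_id, h0.eq_of_src (𝟙 _) 0, Ext.mk₀_zero, Ext.comp_zero]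
  | succ n ih =>
    refine covariant_middle (f := LinearMap.single R (fun _ : Fin (n + 1) ↦ R) 0)
      (g := LinearMap.funLeft R R Fin.succ) (Pi.single_injective (M := fun _ : Fin (n + 1) ↦ R) 0)
      (fun v ↦ ?_)
      (LinearMap.funLeft_surjective_of_injective R R _ (Fin.succ_injective n)) h ih
    constructor
    · intro hv
      refine ⟨v 0, funext fun j ↦ ?_⟩
      refine Fin.cases (by simp) (fun k ↦ ?_) j
      have : v k.succ = 0 := congrFun hv k
      simp [this]
    · rintro ⟨a, rfl⟩
      ext k
      simp [LinearMap.funLeft]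

variable [IsNoetherianRing R] [IsLocalRing R] [Module.Finite R M] [Module.Finite R L]

/-- If `x` is a nonunit and `0 → L → L → L' → 0` is exact, the first map being multiplication by `x`, then
the vanishing of `Ext^i(M, L')` forces that of `Ext^i(M, L)` by Nakayama's lemma. -/
theorem of_smul_exact {x : R} (hx : x ∈ IsLocalRing.maximalIdeal R) {L' : Type u} [AddCommGroup L']
    [Module R L'] {g : L →ₗ[R] L'} (hf : IsSMulRegular L x)
    (hfg : Function.Exact (LinearMap.lsmul R L x) g) (hg : Function.Surjective g) {i : ℕ}
    (h : ExtVanishes R M L' i) : ExtVanishes R M L i := by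
  have hS := shortExact (f := LinearMap.lsmul R L x) hf hfg hg
  have hf : (ModuleCat.shortComplexOfCompEqZero _ g hfg.linearMap_comp_eq_zero).f =
      x • 𝟙 (ModuleCat.of R L) := rfl
  have : (⊤ : Submodule R (Ext (ModuleCat.of R M) (ModuleCat.of R L) i)) ≤
      IsLocalRing.maximalIdeal R • ⊤ := by
    intro e _
    obtain ⟨a, rfl⟩ := Ext.covariant_sequence_exact₂ _ hS e (h.elim _ _)
    rw [hf, Ext.mk₀_smul]
    simpa using Submodule.smul_mem_smul hx Submodule.mem_top
  rw [ExtVanishes, ← Submodule.subsingleton_iff R]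
  refine subsingleton_of_bot_eq_top (Submodule.eq_bot_of_le_smul_of_le_jacobson_bot _ _
    Module.Finite.fg_top this (IsLocalRing.maximalIdeal_le_jacobson _)).symm

end Noetherian

end ExtVanishes

/-! ### Reduction modulo `x` and change of rings -/

/-- `p : M → M'` exhibits `M'` as `M / xM`. -/
structure IsReduction {R : Type*} [CommRing R] (x : R) {M M' : Type*} [AddCommGroup M]
    [Module R M] [AddCommGroup M'] [Module R M'] (p : M →ₗ[R] M') : Prop where
  surjective : Function.Surjective p
  apply_eq_zero_iff : ∀ m, p m = 0 ↔ ∃ n, x • n = m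

namespace IsReduction

variable {R : Type u} [CommRing R] {x : R}

theorem exact {M M' : Type*} [AddCommGroup M] [Module R M] [AddCommGroup M'] [Module R M']
    {p : M →ₗ[R] M'} (hp : IsReduction x p) : Function.Exact (LinearMap.lsmul R M x) p :=
  hp.apply_eq_zero_iff

theorem mkQ (x : R) (M : Type*) [AddCommGroup M] [Module R M] :
    IsReduction x (Submodule.mkQ (x • ⊤ : Submodule R M)) where
  surjective := Submodule.mkQ_surjective _
  apply_eq_zero_iff m := by
    simp [Submodule.mem_smul_pointwise_iff_exists]

theorem algebraLinearMap (x : R) :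
    IsReduction x (Algebra.linearMap R (R ⧸ Ideal.span {x})) where
  surjective := Ideal.Quotient.mk_surjective
  apply_eq_zero_iff r := by
    refine Ideal.Quotient.eq_zero_iff_mem.trans (Ideal.mem_span_singleton.trans ?_)
    simp [dvd_iff_exists_eq_mul_right, eq_comm]

theorem exists_factor_of_ker_le {S M M' N : Type*} [CommRing S] [Algebra R S]
    (hS : Function.Surjective (algebraMap R S)) [AddCommGroup M] [Module R M]
    [AddCommGroup M'] [Module R M'] [Module S M'] [IsScalarTower R S M']
    [AddCommGroup N] [Module R N] [Module S N] [IsScalarTower R S N]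
    {p : M →ₗ[R] M'} (hp : Function.Surjective p) {φ : M →ₗ[R] N}
    (hle : ∀ m, p m = 0 → φ m = 0) : ∃ φ' : M' →ₗ[S] N, ∀ m, φ' (p m) = φ m := by
  let e := p.quotKerEquivOfSurjective hp
  refine ⟨LinearMap.extendScalarsOfSurjective hS
    ((LinearMap.ker p).liftQ φ hle ∘ₗ e.symm.toLinearMap), fun m ↦ ?_⟩
  have : e.symm (p m) = Submodule.Quotient.mk m := by
    rw [LinearEquiv.symm_apply_eq]; rfl
  change (LinearMap.ker p).liftQ φ hle (e.symm (p m)) = φ m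
  rw [this]
  rfl

section

variable {S : Type*} [CommRing S] [Algebra R S] (hS : IsReduction x (Algebra.linearMap R S))
  {M M' F F' N : Type*} [AddCommGroup M] [Module R M]
  [AddCommGroup M'] [Module R M'] [Module S M'] [AddCommGroup F] [Module R F]
  [AddCommGroup F'] [Module R F'] [Module S F'] [IsScalarTower R S F']
  [AddCommGroup N] [Module R N] [Module S N] [IsScalarTower R S N]
include hS

theorem smul_eq_zero (n : N) : x • n = 0 := by
  have : algebraMap R S x = 0 := (hS.apply_eq_zero_iff x).2 ⟨1, by simp⟩
  rw [← algebraMap_smul S, this, zero_smul]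

theorem exists_factor {q : F →ₗ[R] F'} (hq : IsReduction x q) (φ : F →ₗ[R] N) :
    ∃ φ' : F' →ₗ[S] N, ∀ m, φ' (q m) = φ m := by
  refine exists_factor_of_ker_le hS.surjective hq.surjective fun m hm ↦ ?_
  obtain ⟨n, rfl⟩ := (hq.apply_eq_zero_iff m).1 hm
  rw [map_smul, hS.smul_eq_zero]

theorem pi (ι : Type*) : IsReduction x ((Algebra.linearMap R S).compLeft ι) where
  surjective := hS.surjective.comp_left
  apply_eq_zero_iff v := by
    constructor
    · intro hv
      have : ∀ i, ∃ r, x • r = v i := fun i ↦ (hS.apply_eq_zero_iff _).1 (congrFun hv i)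
      choose r hr using this
      exact ⟨r, funext hr⟩
    · rintro ⟨w, rfl⟩
      rw [map_smul]
      exact funext fun i ↦ hS.smul_eq_zero (N := S) _

/-- Reduction modulo a regular element preserves kernels of surjections. -/
theorem exists_ker {p : M →ₗ[R] M'} (hp : IsReduction x p) (hM : IsSMulRegular M x) {q : F →ₗ[R] F'}
    (hq : IsReduction x q) {g : F →ₗ[R] M} (hg : Function.Surjective g) {g' : F' →ₗ[S] M'}
    (h : ∀ f, g' (q f) = p (g f)) :
    ∃ r : LinearMap.ker g →ₗ[R] LinearMap.ker g', IsReduction x r ∧ ∀ k, (r k : F') = q k := by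
  have hle (k : LinearMap.ker g) : q k ∈ LinearMap.ker g' := by
    rw [LinearMap.mem_ker, h, LinearMap.mem_ker.1 k.2, map_zero]
  refine ⟨{ toFun := fun k ↦ ⟨q k, hle k⟩, map_add' := fun _ _ ↦ Subtype.ext (by simp),
            map_smul' := fun _ _ ↦ Subtype.ext (by simp) }, ⟨?_, ?_⟩, fun _ ↦ rfl⟩
  · rintro ⟨f', hf'⟩
    obtain ⟨f, rfl⟩ := hq.surjective f'
    rw [LinearMap.mem_ker, h] at hf'
    obtain ⟨m, hm⟩ := (hp.apply_eq_zero_iff _).1 hf'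
    obtain ⟨e, rfl⟩ := hg m
    -- Here `g f = x • g e`, so subtracting `x • e` lands in the kernel without changing the image
    -- in `F'`.
    refine ⟨⟨f - x • e, by simp [hm]⟩, Subtype.ext ?_⟩
    simp [hS.smul_eq_zero]
  · rintro ⟨k, hk⟩
    have hk' : g k = 0 := hk
    constructor
    · intro h0
      obtain ⟨e, rfl⟩ := (hq.apply_eq_zero_iff k).1 (congrArg Subtype.val h0)
      exact ⟨⟨e, hM (by simpa using hk')⟩, rfl⟩
    · rintro ⟨⟨e, he⟩, h0⟩
      have h0 : x • e = k := congrArg Subtype.val h0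
      refine Subtype.ext ?_
      simp [← h0, hS.smul_eq_zero]

end

variable {S : Type u} [CommRing S] [Algebra R S] (hS : IsReduction x (Algebra.linearMap R S))
  {M M' N : Type u} [AddCommGroup M] [Module R M]
  [AddCommGroup M'] [Module R M'] [Module S M'] [IsScalarTower R S M']
  [AddCommGroup N] [Module R N] [Module S N] [IsScalarTower R S N]

include hS in
/-- Base change for the vanishing of `Ext`: if `x` is regular on `R` and on `M`, and `S = R/xR`,
then `Ext_S(M/xM, N)` and `Ext_R(M, N)` vanish in the same positive degrees, for every
`S`-module `N`. -/
theorem extVanishes_iff [IsNoetherianRing R] [Module.Finite R M] (hx : IsSMulRegular R x)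
    {p : M →ₗ[R] M'} (hp : IsReduction x p) (hM : IsSMulRegular M x) {i : ℕ} (hi : 0 < i) :
    ExtVanishes S M' N i ↔ ExtVanishes R M N i := by
  induction i, hi using Nat.le_induction generalizing M M' with
  | base | succ i hi ih =>
    obtain ⟨n, g, hg⟩ := Module.Finite.exists_fin' R M
    have hq := hS.pi (Fin n)
    set q := (Algebra.linearMap R S).compLeft (Fin n)
    obtain ⟨g', h⟩ := hS.exists_factor hq (p ∘ₗ g)
    have hg' : Function.Surjective g' := by
      intro m'
      obtain ⟨m, rfl⟩ := hp.surjective m'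
      obtain ⟨f, rfl⟩ := hg m
      exact ⟨q f, h f⟩
    have hF : IsSMulRegular (Fin n → R) x := .pi fun _ ↦ hx
    obtain ⟨r, hr, hrq⟩ := hS.exists_ker hp hM hq hg h
    have e1 := (LinearMap.ker g).injective_subtype
    have e2 := g.exact_subtype_ker_map
    have e1' := (LinearMap.ker g').injective_subtype
    have e2' := g'.exact_subtype_ker_map
    -- Above degree 1, shift both sides to the syzygies; the second alternative treats degree 1 by
    -- extending maps from the syzygies.
    first
    | rw [← ExtVanishes.syzygy_iff e1 e2 hg hi, ← ExtVanishes.syzygy_iff e1' e2' hg' hi]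
      exact ih hr (hF.submodule _ _)
    | rw [ExtVanishes.one_iff_exists_extension e1 e2 hg,
        ExtVanishes.one_iff_exists_extension e1' e2' hg']
      constructor
      · intro H φ
        obtain ⟨φ', hφ⟩ := hS.exists_factor hr φ
        obtain ⟨ψ, hψ⟩ := H φ'
        refine ⟨ψ.restrictScalars R ∘ₗ q, LinearMap.ext fun k ↦ ?_⟩
        have := LinearMap.congr_fun hψ (r k)
        rw [hφ] at this
        rw [← this]
        simp [hrq]
      · intro H φ'
        obtain ⟨ψ, hψ⟩ := H (φ'.restrictScalars R ∘ₗ r)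
        obtain ⟨ψ', hψ'⟩ := hS.exists_factor hq ψ
        refine ⟨ψ', LinearMap.ext fun k' ↦ ?_⟩
        obtain ⟨k, rfl⟩ := hr.surjective k'
        have := LinearMap.congr_fun hψ k
        simpa [hrq, hψ'] using this

theorem extVanishes_right {L L' : Type u} [AddCommGroup L] [Module R L] [AddCommGroup L']
    [Module R L'] {g : L →ₗ[R] L'} (hg : IsReduction x g) (hL : IsSMulRegular L x) {i : ℕ}
    (h : ∀ j, i ≤ j → ExtVanishes R M L j) : ExtVanishes R M L' i :=
  ExtVanishes.covariant_right (f := LinearMap.lsmul R L x) hL hg.exact hg.surjective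
    (h i le_rfl) (h (i + 1) i.le_succ)

/-- The exact sequence `0 → N → M/xM → N₁ → 0`, where `N` is a module over `S = R/xR`, `M` is the
kernel of a surjection `F → N` with `x` regular on `F`, and `N₁` is the kernel of `F/xF → N`. -/
theorem exists_exact_reduction_ker {S N F F' : Type*} [CommRing S] [Algebra R S]
    (hS : IsReduction x (Algebra.linearMap R S)) [AddCommGroup N] [Module R N] [Module S N]
    [IsScalarTower R S N] [AddCommGroup F] [Module R F] [AddCommGroup F'] [Module R F']
    [Module S F'] [IsScalarTower R S F'] (hF : IsSMulRegular F x) {q : F →ₗ[R] F'}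
    (hq : IsReduction x q) {f : F →ₗ[R] N} (hf : Function.Surjective f) {f' : F' →ₗ[S] N}
    (h : ∀ v, f' (q v) = f v) {M' : Type*} [AddCommGroup M'] [Module R M'] [Module S M']
    [IsScalarTower R S M'] {p : LinearMap.ker f →ₗ[R] M'} (hp : IsReduction x p) :
    ∃ (α : N →ₗ[S] M') (β : M' →ₗ[S] LinearMap.ker f'),
      Function.Injective α ∧ Function.Exact α β ∧ Function.Surjective β := by
  obtain ⟨β, hβ⟩ := hS.exists_factor hp (q ∘ₗ (LinearMap.ker f).subtype)
  have hβ' (m : M') : β m ∈ LinearMap.ker f' := by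
    obtain ⟨m, rfl⟩ := hp.surjective m
    rw [hβ, LinearMap.mem_ker]
    exact (h m).trans m.2
  -- The kernel of `M/xM → F/xF` is `xF/xM ≅ F/M ≅ N`; multiplication by `x` realizes this
  -- isomorphism and induces `α`.
  let γ : F →ₗ[R] LinearMap.ker f := (LinearMap.lsmul R F x).codRestrict _ fun v ↦ by
    simp [hS.smul_eq_zero]
  have hγ (v : F) : p (γ v) = 0 ↔ f v = 0 := by
    rw [hp.apply_eq_zero_iff]
    constructor
    · rintro ⟨m, hm⟩
      rw [← hF (congrArg Subtype.val hm)]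
      exact m.2
    · exact fun hv ↦ ⟨⟨v, hv⟩, rfl⟩
  obtain ⟨α, hα⟩ := exists_factor_of_ker_le (φ := p ∘ₗ γ) hS.surjective hf
    fun v ↦ (hγ v).2
  refine ⟨α, β.codRestrict _ hβ', ?_, fun m ↦ ?_, ?_⟩
  · rw [injective_iff_map_eq_zero]
    intro n hn
    obtain ⟨v, rfl⟩ := hf n
    exact (hγ v).1 ((hα v).symm.trans hn)
  · constructor
    · intro hm
      obtain ⟨m, rfl⟩ := hp.surjective m
      obtain ⟨v, hv⟩ := (hq.apply_eq_zero_iff _).1 ((hβ m).symm.trans (congrArg Subtype.val hm))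
      exact ⟨f v, (hα v).trans (congrArg p (Subtype.ext hv))⟩
    · rintro ⟨n, rfl⟩
      obtain ⟨v, rfl⟩ := hf n
      refine Subtype.ext ((congrArg β (hα v)).trans ((hβ _).trans ?_))
      exact (hq.apply_eq_zero_iff _).2 ⟨v, rfl⟩
  · rintro ⟨w, hw⟩
    obtain ⟨v, rfl⟩ := hq.surjective w
    exact ⟨p ⟨v, (h v).symm.trans hw⟩, Subtype.ext (hβ _)⟩

end IsReduction

instance (R M : Type*) [CommRing R] [AddCommGroup M] [Module R M] (x : R) :
    IsScalarTower R (R ⧸ Ideal.span {x}) (M ⧸ (x • ⊤ : Submodule R M)) :=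
  .of_algebraMap_smul fun _ _ ↦ rfl

/-! ### The two implications -/

namespace SAC

variable {R : Type u} [CommRing R] [IsNoetherianRing R] [IsLocalRing R] {x : R}

theorem of_quotient (hxm : x ∈ IsLocalRing.maximalIdeal R) (hx : IsSMulRegular R x)
    (h : SAC (R ⧸ Ideal.span {x})) : SAC R := by
  rintro M hM hMR ⟨k, hMM⟩
  obtain ⟨n, f, hf⟩ := Module.Finite.exists_fin' R M
  let K := LinearMap.ker f
  have e1 := K.injective_subtype
  have e2 := f.exact_subtype_ker_map
  have hF : IsSMulRegular (Fin n → R) x := .pi fun _ ↦ hx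
  have hK : IsSMulRegular K x := hF.submodule _ _
  have hMF (i : ℕ) (hi : 0 < i) : ExtVanishes R M (Fin n → R) i := .pi_fin (hMR i hi) n
  -- Both sides are compared with `Ext^{i+1}(M, K)`.
  have hKK (i : ℕ) (hi : 0 < i) : ExtVanishes R K K i ↔ ExtVanishes R M M i := by
    rw [ExtVanishes.syzygy_iff e1 e2 hf hi]
    exact ⟨fun H ↦ .covariant_right e1 e2 hf (hMF i hi) H,
      fun H ↦ .covariant_left e1 e2 hf H (hMF (i + 1) i.succ_pos)⟩
  have hKR (i : ℕ) (hi : 0 < i) : ExtVanishes R K R i :=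
    (ExtVanishes.syzygy_iff e1 e2 hf hi).2 (hMR (i + 1) i.succ_pos)
  have hS := IsReduction.algebraLinearMap x
  have hp := IsReduction.mkQ x K
  have : Module.Finite (R ⧸ Ideal.span {x}) (K ⧸ (x • ⊤ : Submodule R K)) :=
    .of_restrictScalars_finite R _ _
  have key := h (ModuleCat.of _ (K ⧸ (x • ⊤ : Submodule R K))) this
    (fun i hi ↦ (hS.extVanishes_iff hx hp hK hi).2 <|
      hS.extVanishes_right hx fun j hj ↦ hKR j (hi.trans_le hj))
    ⟨k, fun i hi ↦ (hS.extVanishes_iff hx hp hK (k.zero_le.trans_lt hi)).2 <|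
      hp.extVanishes_right hK fun j hj ↦
        (hKK j (k.zero_le.trans_lt (hi.trans_le hj))).2 (hMM j (hi.trans_le hj))⟩
  exact fun i hi ↦ (hKK i hi).1 <| .of_smul_exact hxm hK hp.exact hp.surjective <|
    (hS.extVanishes_iff hx hp hK hi).1 (key i hi)

theorem quotient (hxm : x ∈ IsLocalRing.maximalIdeal R) (hx : IsSMulRegular R x) (h : SAC R) :
    SAC (R ⧸ Ideal.span {x}) := by
  rintro N hN hNS ⟨k, hNN⟩
  let S := R ⧸ Ideal.span {x}
  let : Module R N := Module.compHom N (algebraMap R S)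
  have : IsScalarTower R S N := .of_algebraMap_smul fun _ _ ↦ rfl
  have : Module.Finite R N := .trans S N
  have hS := IsReduction.algebraLinearMap x
  obtain ⟨n, f, hf⟩ := Module.Finite.exists_fin' R N
  have hF : IsSMulRegular (Fin n → R) x := .pi fun _ ↦ hx
  have hq := hS.pi (Fin n)
  obtain ⟨f', hf'⟩ := hS.exists_factor hq f
  have hf's : Function.Surjective f' := fun y ↦ by
    obtain ⟨v, rfl⟩ := hf y
    exact ⟨_, hf' v⟩
  let M := LinearMap.ker f
  let M' := M ⧸ (x • ⊤ : Submodule R M)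
  let N₁ := LinearMap.ker f'
  have hM : IsSMulRegular M x := hF.submodule _ _
  have hp : IsReduction x (Submodule.mkQ (x • ⊤ : Submodule R M)) := .mkQ x M
  obtain ⟨α, β, hα, hαβ, hβ⟩ := hS.exists_exact_reduction_ker hF hq hf hf' hp
  have e1 := N₁.injective_subtype
  have e2 := f'.exact_subtype_ker_map
  have d1 := M.injective_subtype
  have d2 := f.exact_subtype_ker_map
  have hN₁ {L : Type u} [AddCommGroup L] [Module S L] {i : ℕ} (hi : 0 < i) :
      ExtVanishes S N₁ L i ↔ ExtVanishes S N L (i + 1) :=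
    ExtVanishes.syzygy_iff e1 e2 hf's hi
  have hM' {L : Type u} [AddCommGroup L] [Module R L] [Module S L] [IsScalarTower R S L] {i : ℕ}
      (hi : 0 < i) : ExtVanishes S M' L i ↔ ExtVanishes R M L i :=
    hS.extVanishes_iff hx hp hM hi
  have hNF (i : ℕ) (hi : 0 < i) : ExtVanishes S N (Fin n → S) i := .pi_fin (hNS i hi) n
  have hMR (i : ℕ) (hi : 0 < i) : ExtVanishes R M R i := by
    refine .of_smul_exact hxm hx hS.exact hS.surjective ((hM' hi).1 ?_)
    exact .contravariant_middle hα hαβ hβ (hNS i hi) ((hN₁ hi).2 (hNS (i + 1) i.succ_pos))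
  have hNN₁ (i : ℕ) (hi : k < i) : ExtVanishes S N N₁ (i + 1) :=
    .covariant_left e1 e2 hf's (hNN i hi) (hNF _ i.succ_pos)
  -- The bound grows by one because replacing `N` by `N₁` in the second variable costs one degree.
  have hMM (i : ℕ) (hi : k + 1 < i) : ExtVanishes R M M i := by
    have hi0 : 0 < i := by lia
    obtain ⟨j, rfl⟩ : ∃ j, i = j + 1 := ⟨i - 1, by lia⟩
    refine .of_smul_exact hxm hM hp.exact hp.surjective ((hM' hi0).1 ?_)
    refine .covariant_middle hα hαβ hβ ?_ ?_
    · exact .contravariant_middle hα hαβ hβ (hNN _ (by lia)) ((hN₁ hi0).2 (hNN _ (by lia)))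
    · exact .contravariant_middle hα hαβ hβ (hNN₁ _ (by lia)) ((hN₁ hi0).2 (hNN₁ _ (by lia)))
  have hMM_all : ∀ i, 0 < i → ExtVanishes R M M i :=
    h (ModuleCat.of R M) inferInstance hMR ⟨k + 1, hMM⟩
  have hMN (i : ℕ) (hi : 0 < i) : ExtVanishes S M' N i :=
    (hM' hi).2 (.covariant_right d1 d2 hf (.pi_fin (hMR i hi) n) (hMM_all (i + 1) i.succ_pos))
  have descend (i : ℕ) (hi : 0 < i) (H : ExtVanishes S N N (i + 2)) : ExtVanishes S N N i :=
    .contravariant_left hα hαβ hβ (hMN i hi) ((hN₁ i.succ_pos).2 H)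
  have descend_iterate (j : ℕ) : ∀ i, 0 < i → k < i + 2 * j → ExtVanishes S N N i := by
    induction j with
    | zero => exact fun i _ hi ↦ hNN i hi
    | succ j ih => exact fun i hi hk ↦ descend i hi (ih (i + 2) (by lia) (by lia))
  -- Since `i > 0`, `k` double steps suffice: `i + 2 * k > k`.
  exact fun i hi ↦ descend_iterate k i hi (by lia)

end SAC

/-- For a Noetherian local ring `R` and a non-zerodivisor `x` in its maximal ideal (so `R` has
positive depth), `R` satisfies (SAC) if and only if `R/xR` does. -/
theorem corollary2p4 (R : Type u) [CommRing R] [IsNoetherianRing R] [IsLocalRing R]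
    (x : R) (hxm : x ∈ IsLocalRing.maximalIdeal R) (hx : x ∈ nonZeroDivisors R) :
    SAC R ↔ SAC (R ⧸ Ideal.span {x}) := by
  have hreg : IsSMulRegular R x := fun a b hab ↦
    (mul_cancel_left_mem_nonZeroDivisors hx).1 hab
  exact ⟨SAC.quotient hxm hreg, SAC.of_quotient hxm hreg⟩
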